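/- Let $d\ge 2$, let $\pi$ be the permutation representation of $S_n$ on $(\mathbb C^d)^{\otimes n}$, $\pi(\sigma)(e_{i_1}\otimes\cdots\otimes e_{i_n})=e_{i_{\sigma^{-1}(1)}}\otimes\cdots\otimes e_{i_{\sigma^{-1}(n)}}$, and let $\widetilde\pi$ be its linear extension to the group algebra $\mathbb C[S_n]$. Call $f=\sum_\sigma c_\sigma\sigma\in\mathbb C[S_n]$ $k$-local if every $\sigma$ with $c_\sigma\ne 0$ moves at most $k$ of the $n$ points, and put $C=\max_\sigma|c_\sigma|$. Circuits act on $n$ system qudits and finitely many ancilla qudits of dimension $d$. They consist of unitaries on the ancilla register alone and of SWAP gates controlled by the ancilla register: for functions $p,q$ from the computational basis states of the register to the $n$ sites, such a gate is $\sum_b|b\rangle\langle b|\otimes\pi((p(b)\;q(b)))$, so that for each basis state $b$ it swaps one pair of system qudits (or does nothing, if $p(b)=q(b)$). The SWAP gates are counted, the ancilla unitaries are not. A unitary $U$ on $(\mathbb C^d)^{\otimes n}$ is called a Schur transform onto a Young basis if the vectors $U|x\rangle$, for $x$ in the computational basis, form a Young-Yamanouchi basis: they are the vectors $|w,T\rangle$,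 where $w$ labels the copies of irreducible $S_n$-representations in a decomposition of $(\mathbb C^d)^{\otimes n}$ and $T$ runs over all standard Young tableaux of the shape of the copy $w$, and adjacent transpositions act on them by Young's orthogonal form. **Theorem.** There is an absolute constant $A>0$ such that the following holds for all integers $d\ge2$ and $n,k\ge0$, all $k$-local $f\in\mathbb C[S_n]$ for which $H=\widetilde\pi(f)$ is Hermitian, and all real $t,\varepsilon>0$ with $tCkn^k\ge 1$ and $tCkn^k/\varepsilon>e$. There is a circuit $W$ with at most $$A\; t\,C\,k^3\,n^k\;\frac{\log (tCkn^k/\varepsilon)}{\log\log (tCkn^k/\varepsilon)}$$ SWAP gates such that, for every Schur transform $U$ onto a Young basis and all basis vectors $|u\rangle=U|x\rangle$, $|v\rangle=U|y\rangle$ of it, $$\bigl|\,\langle 0\cdots0|\langle u|\,W\,|0\cdots0\rangle|v\rangle-\langle u|\exp(-itH)|v\rangle\,\bigr|\le\varepsilon ,$$ where $|0\cdots 0\rangle$ is the initial state of the ancilla register. -/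

import Mathlib

open scoped Matrix Kronecker

noncomputable section

namespace QuditSim

/-- The computational basis of `n` qudits of dimension `d`: the configuration `x` stands for
`e_{x 0} ⊗ ⋯ ⊗ e_{x (n-1)}`. Operators on `(ℂ^d)^{⊗n}` are matrices indexed by it. -/
abbrev Config (d n : ℕ) : Type := Fin n → Fin d

/-- The permutation representation `π(σ)`: it sends the basis vector `e_y` to the basis vector
`e_{y ∘ σ⁻¹}`, that is, it moves the qudit at site `i` to the site `σ i`. -/
def permOp (d : ℕ) {n : ℕ} (σ : Equiv.Perm (Fin n)) : Matrix (Config d n) (Config d n) ℂ :=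
  Matrix.of fun x y => if x = y ∘ ⇑σ⁻¹ then 1 else 0

/-- The linear extension of `π` to the group algebra: `π̃(f) = ∑_σ c_σ π(σ)`,
where `c_σ` is the coefficient of `σ` in `f`. -/
def groupAlgOp (d : ℕ) {n : ℕ} (f : MonoidAlgebra ℂ (Equiv.Perm (Fin n))) :
    Matrix (Config d n) (Config d n) ℂ :=
  ∑ σ : Equiv.Perm (Fin n), f.coeff σ • permOp d σ

/-- `f` is `k`-local: every permutation that occurs in `f` moves at most `k` points. -/
def IsLocal {n : ℕ} (k : ℕ) (f : MonoidAlgebra ℂ (Equiv.Perm (Fin n))) : Prop :=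
  ∀ σ : Equiv.Perm (Fin n), f.coeff σ ≠ 0 → σ.support.card ≤ k

/-- The largest modulus of a coefficient of `f`, a maximum over a finite non-empty set. -/
def maxCoeff {n : ℕ} (f : MonoidAlgebra ℂ (Equiv.Perm (Fin n))) : ℝ :=
  ⨆ σ : Equiv.Perm (Fin n), ‖f.coeff σ‖

/-! ### Young bases -/

/-- A standard Young tableau with `n` boxes: `T i` is the box, as (row, column), that carries the
`i`-th entry. All boxes weakly north-west of it carry entries that are at most `i`. -/
def IsStandardTableau {n : ℕ} (T : Fin n → ℕ × ℕ) : Prop :=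
  Function.Injective T ∧ ∀ (i : Fin n) (b : ℕ × ℕ), b ≤ T i → ∃ j ≤ i, T j = b

/-- The content (column minus row) of a box. -/
def content (b : ℕ × ℕ) : ℤ := (b.2 : ℤ) - (b.1 : ℤ)

/-- The vector `U |x⟩`, as a column. -/
def column {d n : ℕ} (U : Matrix.unitaryGroup (Config d n) ℂ) (x : Config d n) : Config d n → ℂ :=
  fun z => U.1 z x

/-- `U` is a Schur transform onto a Young-Yamanouchi basis: the orthonormal vectors `U |x⟩` are
labelled by a standard tableau `T x` and a multiplicity label `w x` of a copy of the
irreducible representation of `S_n` of the same shape. Each copy is spanned by the basis vectors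
with its label, one for every standard tableau of its shape, and the adjacent transpositions act
on it by Young's orthogonal form
`π((i, i+1)) |w, T⟩ = r⁻¹ |w, T⟩ + √(1 - r⁻²) |w, (i, i+1) T⟩`
with the axial distance `r` (the last term being absent if `(i, i+1) T` is not standard). -/
def IsYoungSchurTransform {d n : ℕ} (U : Matrix.unitaryGroup (Config d n) ℂ) : Prop :=
  ∃ (T : Config d n → Fin n → ℕ × ℕ) (w : Config d n → ℕ),
    (∀ x, IsStandardTableau (T x)) ∧
    Function.Injective (fun x => (w x, T x)) ∧
    (∀ x (S : Fin n → ℕ × ℕ), IsStandardTableau S → Set.range S = Set.range (T x) →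
      ∃ y, w y = w x ∧ T y = S) ∧
    ∀ (x : Config d n) (i j : Fin n), (j : ℕ) = (i : ℕ) + 1 →
      let r : ℝ := ((content (T x j) - content (T x i) : ℤ) : ℝ)
      permOp d (Equiv.swap i j) *ᵥ column U x =
        ((r⁻¹ : ℝ) : ℂ) • column U x +
        ((Real.sqrt (1 - (r⁻¹) ^ 2) : ℝ) : ℂ) •
          ∑ y : Config d n, if w y = w x ∧ T y = T x ∘ ⇑(Equiv.swap i j) then column U y else 0

/-! ### Circuits of SWAP gates controlled by an ancilla register -/

/-- A gate on `a` ancilla qudits and `n` system qudits. -/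
inductive Gate (d a n : ℕ) : Type
  /-- a unitary on the ancilla register -/
  | ancilla (V : Matrix.unitaryGroup (Config d a) ℂ) : Gate d a n
  /-- a SWAP gate controlled by the ancilla register: if the register is in the computational basis
  state `b`, the system qudits at the sites `p b` and `q b` are swapped
  (nothing happens if `p b = q b`) -/
  | swap (p q : Config d a → Fin n) : Gate d a n

/-- The operator of a gate on ancilla ⊗ system. -/
def Gate.toMatrix {d a n : ℕ} :
    Gate d a n → Matrix (Config d a × Config d n) (Config d a × Config d n) ℂ
  | .ancilla V => V.1 ⊗ₖ (1 : Matrix (Config d n) (Config d n) ℂ)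
  | .swap p q => Matrix.of fun s s' =>
      if s.1 = s'.1 then permOp d (Equiv.swap (p s'.1) (q s'.1)) s.2 s'.2 else 0

/-- A circuit is a list of gates, and the first gate in the list is applied first. -/
abbrev Circuit (d a n : ℕ) : Type := List (Gate d a n)

/-- The operator of a circuit on ancilla ⊗ system. -/
def Circuit.toMatrix {d a n : ℕ} :
    Circuit d a n → Matrix (Config d a × Config d n) (Config d a × Config d n) ℂ
  | [] => 1
  | g :: c => Circuit.toMatrix c * g.toMatrix

/-- The number of SWAP gates of a circuit. -/
def Circuit.swapCount {d a n : ℕ} : Circuit d a n → ℕ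
  | [] => 0
  | .ancilla _ :: c => Circuit.swapCount c
  | .swap _ _ :: c => Circuit.swapCount c + 1

/-- The state `|0 ⋯ 0⟩ ⊗ |v⟩` of ancilla ⊗ system. -/
def withAncilla {d n : ℕ} (a : ℕ) [NeZero d] (v : Config d n → ℂ) : Config d a × Config d n → ℂ :=
  fun s => if s.1 = 0 then v s.2 else 0

/-- The matrix element `⟨u| M |v⟩`. -/
def matrixElement {ι : Type} [Fintype ι] (u : ι → ℂ) (M : Matrix ι ι ℂ) (v : ι → ℂ) : ℂ :=
  star u ⬝ᵥ (M *ᵥ v)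

end QuditSim

end

/-!
The evolution is simulated by a truncated Taylor series, implemented as a linear combination of unitaries
with oblivious amplitude amplification. That `U` is a Schur transform onto a Young basis matters only
through the orthonormality of the vectors `U |x⟩`: the circuit approximates `exp (-itH)` in operator
norm.

An operator on register ⊗ system is written as a matrix, indexed by the states of the register, with
entries in the algebra of system operators. A system operator `B` is *encoded with `m` gates* (`Encodes`)
if it is the block `⟨i₀| M |i₀⟩` of a circuit operator `M` with `m` controlled gates on some finite
register. Since register unitaries are free and gates may be controlled arbitrarily, encodings have
three closure properties:

* products (`Encodes.mul`): the gate numbers add up, each factor having a register of its own;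
* combinations `∑ c_j B_j` with `∑ |c_j| ≤ 1` (`Encodes.sum`): the gate number does not grow, because
  the circuits for the `B_j` run side by side on orthogonal states of the register;
* amplification `B ↦ 3 B - 4 B B* B` (`Encodes.amplify`): the gate number triples. If `B` is half of a
  unitary, the result is this unitary.

A `k`-local permutation is a product of at most `k` transpositions and there are at most `n ^ k` of
them, so `h = H / (C n ^ k)` is encoded with `k` gates (`encodes_groupAlgOp`). For `τ ≤ 1 / 2`, half of
the Taylor polynomial of `exp (-iτh)` of degree below `K` has coefficients of total modulus at most
`1`, so it is encoded with `K k` gates, and amplification restores the factor `2` with an error of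
order `2 ^ (-K) / K!`. The power of `r` such segments approximates `exp (-i r τ h)`; as encoded operators
are contractions (`Encodes.norm_le_one`), the errors only add up. The choice of `r` and `K` is made in
`exists_circuit_approx_exp`, and `exp_le_factorial` is the source of the quotient `log / log log`.
-/

set_option linter.unusedSectionVars false

namespace QuditSim

open Matrix

/-! ### Circuit operators over a star algebra -/

section CircuitOperators

variable {R : Type*} [Ring R] [StarRing R] [Algebra ℂ R] [StarModule ℂ R]

/-- A set of unitaries that contains `1` and is closed under `star`: the values that the system part
of a controlled gate may take. -/
structure IsGateSet (G : Set R) : Prop where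
  one_mem : 1 ∈ G
  star_mem : ∀ g ∈ G, star g ∈ G
  mem_unitary : ∀ g ∈ G, g ∈ unitary R

/-- `IsCircuitOp G m M`: the operator `M` on register ⊗ system, an `ι × ι` matrix with entries in the
algebra `R` of system operators, is a product `V₀ D₁ V₁ ⋯ Dₘ Vₘ` of register unitaries `Vᵢ` (matrices
of scalars) and `m` gates `Dᵢ` with values in `G` controlled by the register (diagonal matrices). -/
def IsCircuitOp (G : Set R) {ι : Type*} [Fintype ι] [DecidableEq ι] : ℕ → Matrix ι ι R → Prop
  | 0, M => ∃ V ∈ unitaryGroup ι ℂ, M = V.map (algebraMap ℂ R)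
  | m + 1, M => ∃ V ∈ unitaryGroup ι ℂ, ∃ g : ι → R, (∀ i, g i ∈ G) ∧
      ∃ M', IsCircuitOp G m M' ∧ M = V.map (algebraMap ℂ R) * diagonal g * M'

variable {G : Set R} {ι κ : Type*} [Fintype ι] [DecidableEq ι] [Fintype κ] [DecidableEq κ]

theorem IsCircuitOp.unitary_mul {m : ℕ} {M : Matrix ι ι R} (hM : IsCircuitOp G m M)
    {V : Matrix ι ι ℂ} (hV : V ∈ unitaryGroup ι ℂ) :
    IsCircuitOp G m (V.map (algebraMap ℂ R) * M) := by
  cases m with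
  | zero =>
    obtain ⟨W, hW, rfl⟩ := hM
    exact ⟨V * W, mul_mem hV hW, by rw [Matrix.map_mul]⟩
  | succ m =>
    obtain ⟨W, hW, g, hg, M', hM', rfl⟩ := hM
    exact ⟨V * W, mul_mem hV hW, g, hg, M', hM', by simp only [Matrix.map_mul, Matrix.mul_assoc]⟩

theorem IsCircuitOp.mul {m m' : ℕ} {M N : Matrix ι ι R} (hM : IsCircuitOp G m M)
    (hN : IsCircuitOp G m' N) : IsCircuitOp G (m + m') (M * N) := by
  induction m generalizing M with
  | zero =>
    obtain ⟨V, hV, rfl⟩ := hM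
    rw [Nat.zero_add]
    exact hN.unitary_mul hV
  | succ m ih =>
    obtain ⟨V, hV, g, hg, M', hM', rfl⟩ := hM
    rw [Nat.succ_add]
    exact ⟨V, hV, g, hg, M' * N, ih hM', by simp only [Matrix.mul_assoc]⟩

theorem isCircuitOp_unitary {V : Matrix ι ι ℂ} (hV : V ∈ unitaryGroup ι ℂ) :
    IsCircuitOp G 0 (V.map (algebraMap ℂ R)) := ⟨V, hV, rfl⟩

theorem isCircuitOp_one : IsCircuitOp G 0 (1 : Matrix ι ι R) :=
  ⟨1, one_mem _, by simp [Matrix.map_one]⟩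

theorem isCircuitOp_diagonal {g : ι → R} (hg : ∀ i, g i ∈ G) : IsCircuitOp G 1 (diagonal g) :=
  ⟨1, one_mem _, g, hg, 1, isCircuitOp_one, by simp [Matrix.map_one]⟩

theorem IsCircuitOp.mono (hG : IsGateSet G) {m m' : ℕ} (h : m ≤ m') {M : Matrix ι ι R}
    (hM : IsCircuitOp G m M) : IsCircuitOp G m' M := by
  induction h with
  | refl => exact hM
  | step _ ih =>
    exact ⟨1, one_mem _, fun _ => 1, fun _ => hG.one_mem, M, ih, by simp [Matrix.map_one]⟩

theorem conjTranspose_map_algebraMap (V : Matrix ι κ ℂ) :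
    (V.map (algebraMap ℂ R))ᴴ = Vᴴ.map (algebraMap ℂ R) :=
  (Matrix.conjTranspose_map _ fun r => algebraMap_star_comm r).symm

theorem IsCircuitOp.conjTranspose (hG : IsGateSet G) {m : ℕ} {M : Matrix ι ι R}
    (hM : IsCircuitOp G m M) : IsCircuitOp G m Mᴴ := by
  induction m generalizing M with
  | zero =>
    obtain ⟨V, hV, rfl⟩ := hM
    exact ⟨Vᴴ, Unitary.star_mem hV, conjTranspose_map_algebraMap V⟩
  | succ m ih =>
    obtain ⟨V, hV, g, hg, M', hM', rfl⟩ := hM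
    rw [Matrix.conjTranspose_mul, Matrix.conjTranspose_mul, Matrix.diagonal_conjTranspose,
      conjTranspose_map_algebraMap]
    exact (ih hM').mul ((isCircuitOp_diagonal fun i => hG.star_mem _ (hg i)).mul
      (isCircuitOp_unitary (Unitary.star_mem hV)))

theorem IsCircuitOp.conjTranspose_mul_self (hG : IsGateSet G) {m : ℕ} {M : Matrix ι ι R}
    (hM : IsCircuitOp G m M) : Mᴴ * M = 1 := by
  have key : ∀ V ∈ unitaryGroup ι ℂ,
      (V.map (algebraMap ℂ R))ᴴ * V.map (algebraMap ℂ R) = 1 := by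
    intro V hV
    rw [conjTranspose_map_algebraMap, ← Matrix.map_mul, ← Matrix.star_eq_conjTranspose,
      Unitary.star_mul_self_of_mem hV]
    simp [Matrix.map_one]
  induction m generalizing M with
  | zero =>
    obtain ⟨V, hV, rfl⟩ := hM
    exact key V hV
  | succ m ih =>
    obtain ⟨V, hV, g, hg, M', hM', rfl⟩ := hM
    have hD : (diagonal g)ᴴ * diagonal g = 1 := by
      rw [Matrix.diagonal_conjTranspose, Matrix.diagonal_mul_diagonal, ← Matrix.diagonal_one]
      congr 1
      ext i
      exact Unitary.star_mul_self_of_mem (hG.mem_unitary _ (hg i))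
    rw [Matrix.conjTranspose_mul, Matrix.conjTranspose_mul]
    calc M'ᴴ * ((diagonal g)ᴴ * (V.map (algebraMap ℂ R))ᴴ) *
          (V.map (algebraMap ℂ R) * diagonal g * M')
        = M'ᴴ * ((diagonal g)ᴴ * ((V.map (algebraMap ℂ R))ᴴ * V.map (algebraMap ℂ R)) *
            diagonal g) * M' := by simp only [Matrix.mul_assoc]
      _ = 1 := by rw [key V hV, Matrix.mul_one, hD, Matrix.mul_one, ih hM']

theorem submatrix_mem_unitaryGroup (e : κ ≃ ι) {V : Matrix ι ι ℂ} (hV : V ∈ unitaryGroup ι ℂ) :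
    V.submatrix e e ∈ unitaryGroup κ ℂ := by
  rw [mem_unitaryGroup_iff] at hV ⊢
  rw [star_eq_conjTranspose] at hV ⊢
  rw [conjTranspose_submatrix, submatrix_mul_equiv, hV, submatrix_one_equiv]

/-- The states of the register may be renamed. -/
theorem IsCircuitOp.submatrix {m : ℕ} {M : Matrix ι ι R} (hM : IsCircuitOp G m M) (e : κ ≃ ι) :
    IsCircuitOp G m (M.submatrix e e) := by
  induction m generalizing M with
  | zero =>
    obtain ⟨V, hV, rfl⟩ := hM
    exact ⟨V.submatrix e e, submatrix_mem_unitaryGroup e hV, rfl⟩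
  | succ m ih =>
    obtain ⟨V, hV, g, hg, M', hM', rfl⟩ := hM
    refine ⟨V.submatrix e e, submatrix_mem_unitaryGroup e hV, g ∘ e, fun i => hg _,
      M'.submatrix e e, ih hM', ?_⟩
    rw [← submatrix_diagonal_equiv, ← submatrix_mul_equiv _ _ e e e, ← submatrix_mul_equiv _ _ e e e,
      submatrix_map]

/-- The register may be enlarged by states on which the circuit does nothing. -/
theorem IsCircuitOp.fromBlocks_one (hG : IsGateSet G) {m : ℕ} {M : Matrix ι ι R}
    (hM : IsCircuitOp G m M) :
    IsCircuitOp G m (fromBlocks M 0 0 (1 : Matrix κ κ R)) := by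
  have key : ∀ V ∈ unitaryGroup ι ℂ, fromBlocks V 0 0 (1 : Matrix κ κ ℂ) ∈
      unitaryGroup (ι ⊕ κ) ℂ := by
    intro V hV
    rw [mem_unitaryGroup_iff, star_eq_conjTranspose] at hV ⊢
    simp [fromBlocks_conjTranspose, fromBlocks_multiply, hV]
  induction m generalizing M with
  | zero =>
    obtain ⟨V, hV, rfl⟩ := hM
    exact ⟨_, key V hV, by simp [fromBlocks_map, Matrix.map_one, Matrix.map_zero]⟩
  | succ m ih =>
    obtain ⟨V, hV, g, hg, M', hM', rfl⟩ := hM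
    refine ⟨_, key V hV, Sum.elim g 1, ?_, _, ih hM', ?_⟩
    · rintro (i | i)
      · exact hg i
      · exact hG.one_mem
    · rw [← fromBlocks_diagonal]
      simp [fromBlocks_map, Matrix.map_one, Matrix.map_zero, fromBlocks_multiply]

/-- Circuits with equally many gates can be run side by side, controlled by a further register, with
no additional gates. -/
theorem IsCircuitOp.blockDiagonal' {J : Type*} [Fintype J] [DecidableEq J] {ι : J → Type*}
    [∀ j, Fintype (ι j)] [∀ j, DecidableEq (ι j)] {m : ℕ} {M : ∀ j, Matrix (ι j) (ι j) R}
    (hM : ∀ j, IsCircuitOp G m (M j)) : IsCircuitOp G m (Matrix.blockDiagonal' M) := by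
  have key : ∀ V : ∀ j, Matrix (ι j) (ι j) ℂ, (∀ j, V j ∈ unitaryGroup (ι j) ℂ) →
      Matrix.blockDiagonal' V ∈ unitaryGroup (Σ j, ι j) ℂ := by
    intro V hV
    rw [mem_unitaryGroup_iff, star_eq_conjTranspose, blockDiagonal'_conjTranspose,
      ← blockDiagonal'_mul]
    have : (fun j => V j * (V j)ᴴ) = 1 := by
      ext1 j
      exact mem_unitaryGroup_iff.1 (hV j)
    rw [this, blockDiagonal'_one]
  induction m generalizing M with
  | zero =>
    choose V hV hMV using hM
    exact ⟨_, key V hV, by rw [blockDiagonal'_map _ _ (map_zero _), funext hMV]⟩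
  | succ m ih =>
    choose V hV g hg M' hM' hMV using hM
    refine ⟨_, key V hV, fun i => g i.1 i.2, fun i => hg _ _, _, ih hM', ?_⟩
    rw [blockDiagonal'_map _ _ (map_zero _), ← blockDiagonal'_diagonal, ← blockDiagonal'_mul,
      ← blockDiagonal'_mul, funext hMV]

end CircuitOperators

/-! ### Block encodings -/

section Encodings

variable {R : Type*} [Ring R] [StarRing R] [Algebra ℂ R] [StarModule ℂ R] {G : Set R}

/-- `Encodes G m B`: the system operator `B` is the block `⟨i₀| M |i₀⟩` of a circuit operator `M` with
`m` gates, for a state `i₀` of some finite register. -/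
def Encodes (G : Set R) (m : ℕ) (B : R) : Prop :=
  ∃ (ι : Type) (_ : Fintype ι) (_ : DecidableEq ι) (i₀ : ι) (M : Matrix ι ι R),
    IsCircuitOp G m M ∧ M i₀ i₀ = B

theorem Encodes.mono (hG : IsGateSet G) {m m' : ℕ} (h : m ≤ m') {B : R} (hB : Encodes G m B) :
    Encodes G m' B := by
  obtain ⟨ι, _, _, i₀, M, hM, rfl⟩ := hB
  exact ⟨ι, _, _, i₀, M, hM.mono hG h, rfl⟩

theorem encodes_one : Encodes G 0 1 :=
  ⟨Unit, inferInstance, inferInstance, (), 1, isCircuitOp_one, by simp⟩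

theorem encodes_of_mem {g : R} (hg : g ∈ G) : Encodes G 1 g :=
  ⟨Unit, inferInstance, inferInstance, (), diagonal fun _ => g, isCircuitOp_diagonal fun _ => hg,
    by simp⟩

theorem encodes_zero (hG : IsGateSet G) (m : ℕ) : Encodes G m (0 : R) := by
  refine Encodes.mono hG (Nat.zero_le m) ⟨Fin 2, inferInstance, inferInstance, 0,
    (!![0, 1; 1, 0] : Matrix (Fin 2) (Fin 2) ℂ).map (algebraMap ℂ R), isCircuitOp_unitary ?_,
    by simp⟩
  rw [mem_unitaryGroup_iff, star_eq_conjTranspose]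
  ext i j
  fin_cases i <;> fin_cases j <;> simp [Matrix.mul_apply]

/-- The blocks of two circuits multiply if the circuits use separate registers. -/
theorem Encodes.mul {m m' : ℕ} {B B' : R} (hB : Encodes G m B) (hB' : Encodes G m' B') :
    Encodes G (m + m') (B * B') := by
  obtain ⟨ι, _, _, i₀, M, hM, rfl⟩ := hB
  obtain ⟨κ, _, _, j₀, N, hN, rfl⟩ := hB'
  let e : κ × ι ≃ Σ _ : κ, ι := (Equiv.sigmaEquivProd κ ι).symm
  let e' : κ × ι ≃ Σ _ : ι, κ := (Equiv.prodComm κ ι).trans (Equiv.sigmaEquivProd ι κ).symm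
  have h1 := (IsCircuitOp.blockDiagonal' (J := κ) fun _ => hM).submatrix e
  have h2 := (IsCircuitOp.blockDiagonal' (J := ι) fun _ => hN).submatrix e'
  refine ⟨κ × ι, inferInstance, inferInstance, (j₀, i₀), _, h1.mul h2, ?_⟩
  rw [Matrix.mul_apply, Finset.sum_eq_single (j₀, i₀)]
  · simp [e, e', blockDiagonal'_apply]
  · rintro ⟨j, i⟩ - hne
    by_cases hj : j₀ = j
    · have hi : i ≠ i₀ := fun h => hne (by rw [hj, h])
      simp [e, e', blockDiagonal'_apply, hi]
    · simp [e, e', blockDiagonal'_apply, hj]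
  · simp

theorem Encodes.pow {m : ℕ} {B : R} (hB : Encodes G m B) (r : ℕ) : Encodes G (r * m) (B ^ r) := by
  induction r with
  | zero => simpa using encodes_one
  | succ r ih =>
    rw [Nat.succ_mul, pow_succ]
    exact ih.mul hB

theorem exists_unitary_column {ι : Type*} [Fintype ι] [DecidableEq ι] (u : ι → ℂ) (i₀ : ι)
    (hu : ∑ i, ‖u i‖ ^ 2 = 1) : ∃ P ∈ unitaryGroup ι ℂ, ∀ i, P i i₀ = u i := by
  have hn : ‖WithLp.toLp 2 u‖ = 1 := by
    rw [EuclideanSpace.norm_eq]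
    simp [hu]
  have ho : Orthonormal ℂ (({i₀} : Set ι).domRestrict fun _ => WithLp.toLp 2 u) := by
    constructor
    · intro i
      simpa using hn
    · intro i j hij
      exact absurd (Subsingleton.elim i j) hij
  obtain ⟨b, hb⟩ := ho.exists_orthonormalBasis_extension_of_card_eq (by simp)
  refine ⟨_, (EuclideanSpace.basisFun ι ℂ).toMatrix_orthonormalBasis_mem_unitary b, fun i => ?_⟩
  rw [Module.Basis.toMatrix_apply, hb i₀ rfl]
  simp

/-- Linear combination of unitaries: the circuits run side by side on a superposition that the register
is prepared in, so the number of gates does not add up. -/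
theorem Encodes.sum_of_sum_norm_eq_one {J : Type} [Fintype J] {m : ℕ}
    {B : J → R} (hB : ∀ j, Encodes G m (B j)) {c : J → ℂ} (hc : ∑ j, ‖c j‖ = 1) :
    Encodes G m (∑ j, c j • B j) := by
  classical
  choose ι hι hι' i₀ M hM hMB using hB
  have hJ : Nonempty J := by
    by_contra h
    rw [not_nonempty_iff] at h
    simp at hc
  obtain ⟨j₀⟩ := hJ
  let b₀ : Σ j, ι j := ⟨j₀, i₀ j₀⟩
  -- `M` is sandwiched between two preparations, with `conj u * v = c` on the states `(j, i₀ j)`.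
  -- Where `c j = 0`, the quotient in `v` is `0 / 0 = 0`, as it should be.
  let u : (Σ j, ι j) → ℂ := fun x => if x.2 = i₀ x.1 then (Real.sqrt ‖c x.1‖ : ℂ) else 0
  let v : (Σ j, ι j) → ℂ := fun x => if x.2 = i₀ x.1 then c x.1 / (Real.sqrt ‖c x.1‖ : ℂ) else 0
  have hu : ∑ x, ‖u x‖ ^ 2 = 1 := by
    rw [← hc, Fintype.sum_sigma]
    refine Finset.sum_congr rfl fun j _ => ?_
    rw [Finset.sum_eq_single (i₀ j) (fun i _ hi => by simp [u, hi]) (by simp)]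
    simp [u]
  have hv : ∑ x, ‖v x‖ ^ 2 = 1 := by
    rw [← hc, Fintype.sum_sigma]
    refine Finset.sum_congr rfl fun j _ => ?_
    rw [Finset.sum_eq_single (i₀ j) (fun i _ hi => by simp [v, hi]) (by simp)]
    by_cases h : ‖c j‖ = 0
    · simp [v, h]
    · simp only [v, if_true, norm_div, Complex.norm_real, Real.norm_eq_abs, div_pow, sq_abs]
      rw [Real.sq_sqrt (norm_nonneg _)]
      field_simp
  obtain ⟨P, hP, hPu⟩ := exists_unitary_column u b₀ hu
  obtain ⟨Q, hQ, hQv⟩ := exists_unitary_column v b₀ hv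
  have h := ((IsCircuitOp.blockDiagonal' hM).mul (isCircuitOp_unitary hQ)).unitary_mul
    (Unitary.star_mem hP)
  refine ⟨Σ j, ι j, inferInstance, inferInstance, b₀, _, h, ?_⟩
  · have hcoef : ∀ j, (Real.sqrt ‖c j‖ : ℂ) * (c j / (Real.sqrt ‖c j‖ : ℂ)) = c j := by
      intro j
      by_cases h : c j = 0
      · simp [h]
      · rw [mul_div_cancel₀]
        simpa using h
    simp only [Matrix.mul_apply, Matrix.map_apply, star_apply, hPu, hQv, Fintype.sum_sigma]
    refine Finset.sum_congr rfl fun j _ => ?_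
    rw [Finset.sum_eq_single (i₀ j) (fun i _ hi => by simp [u, hi]) (by simp)]
    rw [Finset.sum_eq_single j _ (by simp)]
    · rw [Finset.sum_eq_single (i₀ j) (fun i _ hi => by simp [v, hi]) (by simp)]
      simp only [u, v, if_true, blockDiagonal'_apply_eq, hMB]
      rw [← Algebra.commutes, ← mul_assoc, ← map_mul, ← hcoef j, Algebra.smul_def, hcoef]
      simp [hcoef]
    · intro j' _ hj
      simp [blockDiagonal'_apply_ne _ _ _ hj.symm]

theorem Encodes.sum (hG : IsGateSet G) {J : Type} [Fintype J] {m : ℕ} {B : J → R}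
    (hB : ∀ j, Encodes G m (B j)) {c : J → ℂ} (hc : ∑ j, ‖c j‖ ≤ 1) :
    Encodes G m (∑ j, c j • B j) := by
  -- The missing weight is put on an encoding of `0`.
  have h := Encodes.sum_of_sum_norm_eq_one (G := G) (m := m) (J := Option J)
    (B := fun o => o.elim 0 B) (c := fun o => o.elim ((1 - ∑ j, ‖c j‖ : ℝ) : ℂ) c)
    (by rintro (_ | j); exacts [encodes_zero hG m, hB j])
    (by
      rw [Fintype.sum_option]
      simp only [Option.elim]
      rw [Complex.norm_real, Real.norm_of_nonneg (sub_nonneg.2 hc)]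
      ring)
  simpa [Fintype.sum_option] using h

/-- One round of oblivious amplitude amplification: with the reflection `S = 1 - 2 |i₀⟩⟨i₀|` of the
register, the circuit `- M S Mᴴ S M` has the block `3 B - 4 B B* B`. If `2 B` is unitary this is
`2 B`, so the loss of a factor `2` is made up for. -/
theorem Encodes.amplify (hG : IsGateSet G) {m : ℕ} {B : R} (hB : Encodes G m B) :
    Encodes G (3 * m) ((3 : ℂ) • B - (4 : ℂ) • (B * star B * B)) := by
  obtain ⟨ι, _, _, i₀, M, hM, rfl⟩ := hB
  let E : Matrix ι ι R := single i₀ i₀ 1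
  let S : Matrix ι ι ℂ := diagonal fun i => if i = i₀ then -1 else 1
  have hS : S ∈ unitaryGroup ι ℂ := by
    rw [mem_unitaryGroup_iff, star_eq_conjTranspose, diagonal_conjTranspose, diagonal_mul_diagonal,
      ← diagonal_one]
    congr 1
    ext i
    by_cases h : i = i₀ <;> simp [h]
  have hSE : S.map (algebraMap ℂ R) = 1 - 2 • E := by
    ext i j
    by_cases hij : i = j
    · subst hij
      by_cases h : i = i₀
      · subst h
        simp only [S, E, map_apply, diagonal_apply_eq, Matrix.sub_apply, Matrix.smul_apply,
          one_apply_eq, single_apply_same, if_true, map_neg, map_one]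
        norm_num
      · simp [S, E, h, Ne.symm h]
    · have : ¬ (i₀ = i ∧ i₀ = j) := fun h => hij (h.1.symm.trans h.2)
      simp [S, E, hij, this]
  have hneg : -(1 : Matrix ι ι ℂ) ∈ unitaryGroup ι ℂ := by
    rw [mem_unitaryGroup_iff]
    simp
  have hC := ((((hM.mul (isCircuitOp_unitary hS)).mul (hM.conjTranspose hG)).mul
    (isCircuitOp_unitary hS)).mul hM).unitary_mul hneg
  refine ⟨ι, _, _, i₀, _, (by omega : m + 0 + m + 0 + m = 3 * m) ▸ hC, ?_⟩
  have h1 : (-(1 : Matrix ι ι ℂ)).map (algebraMap ℂ R) = -1 := by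
    ext i j
    by_cases h : i = j <;> simp [h]
  have hMM := hM.conjTranspose_mul_self hG
  have hMM' : M * Mᴴ = 1 := by
    have h := (hM.conjTranspose hG).conjTranspose_mul_self hG
    rwa [conjTranspose_conjTranspose] at h
  have hexp : -1 * (M * (1 - 2 • E) * Mᴴ * (1 - 2 • E) * M) =
      -M + 2 • (M * E) + 2 • (E * M) - 4 • (M * E * Mᴴ * E * M) := by
    have e1 : M * (1 - 2 • E) * Mᴴ * (1 - 2 • E) * M = M * Mᴴ * M - 2 • (M * E * (Mᴴ * M))
        - 2 • ((M * Mᴴ) * E * M) + 4 • (M * E * Mᴴ * E * M) := by noncomm_ring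
    rw [e1, hMM, hMM']
    noncomm_ring
  rw [h1, hSE, hexp]
  have a1 : (M * E) i₀ i₀ = M i₀ i₀ := by simp [E]
  have a2 : (E * M) i₀ i₀ = M i₀ i₀ := by simp [E]
  have a3 : (M * E * Mᴴ * E * M) i₀ i₀ = M i₀ i₀ * star (M i₀ i₀) * M i₀ i₀ := by
    rw [Matrix.mul_assoc _ E M, Matrix.mul_apply, Finset.sum_eq_single i₀]
    · rw [Matrix.mul_apply, Finset.sum_eq_single i₀]
      · simp [E]
      · intro i _ hi
        rw [mul_single_apply_of_ne _ _ _ _ _ hi, zero_mul]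
      · simp
    · intro i _ hi
      rw [single_mul_apply_of_ne _ _ _ _ _ hi, mul_zero]
    · simp
  simp only [Matrix.sub_apply, Matrix.add_apply, Matrix.neg_apply, Matrix.smul_apply, a1, a2, a3]
  have h3 : (3 : ℂ) • M i₀ i₀ = 3 • M i₀ i₀ := by
    rw [← Nat.cast_smul_eq_nsmul ℂ]; norm_num
  have h4 : (4 : ℂ) • (M i₀ i₀ * star (M i₀ i₀) * M i₀ i₀) =
      4 • (M i₀ i₀ * star (M i₀ i₀) * M i₀ i₀) := by
    rw [← Nat.cast_smul_eq_nsmul ℂ]; norm_num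
  rw [h3, h4]
  abel

end Encodings

/-! ### Approximation of the exponential by block encodings -/

section Exponential

variable {R : Type*} [CStarAlgebra R] [Nontrivial R] {G : Set R}

theorem Encodes.norm_le_one (hG : IsGateSet G) {m : ℕ} {B : R} (hB : Encodes G m B) :
    ‖B‖ ≤ 1 := by
  let := CStarAlgebra.spectralOrder R
  have := CStarAlgebra.spectralOrderedRing R
  obtain ⟨ι, _, _, i₀, M, hM, rfl⟩ := hB
  have hsum : ∑ i, star (M i i₀) * M i i₀ = 1 := by
    have h := congr_fun₂ (hM.conjTranspose_mul_self hG) i₀ i₀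
    simpa [Matrix.mul_apply] using h
  have hle : star (M i₀ i₀) * M i₀ i₀ ≤ 1 := by
    rw [← hsum]
    exact Finset.single_le_sum (f := fun i => star (M i i₀) * M i i₀)
      (fun i _ => star_mul_self_nonneg (M i i₀)) (Finset.mem_univ i₀)
  have h := CStarAlgebra.norm_le_norm_of_nonneg_of_le (star_mul_self_nonneg (M i₀ i₀)) hle
  rw [CStarRing.norm_star_mul_self, CStarRing.norm_one] at h
  nlinarith [norm_nonneg (M i₀ i₀)]

theorem norm_exp_sub_sum_range_le (x : R) (hx : ‖x‖ ≤ 1) {K : ℕ} (hK : 0 < K) :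
    ‖NormedSpace.exp x - ∑ j ∈ Finset.range K, ((j.factorial : ℂ)⁻¹) • x ^ j‖ ≤
      ‖x‖ ^ K * (K + 1) / (K.factorial * K) := by
  have h1 := (hasSum_nat_add_iff' K).2 (NormedSpace.exp_series_hasSum_exp' (𝕂 := ℂ) x)
  have h2 := (hasSum_nat_add_iff' K).2 (NormedSpace.exp_series_hasSum_exp' (𝕂 := ℝ) ‖x‖)
  refine (h1.norm_le_of_bounded h2 fun i => ?_).trans ?_
  · rw [norm_smul, norm_inv, Complex.norm_natCast, smul_eq_mul]
    gcongr
    exact norm_pow_le x _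
  · have h := Real.exp_bound' (norm_nonneg x) hx hK
    rw [Real.exp_eq_exp_ℝ] at h
    have : ∑ i ∈ Finset.range K, ((i.factorial : ℝ)⁻¹) • ‖x‖ ^ i =
        ∑ i ∈ Finset.range K, ‖x‖ ^ i / i.factorial :=
      Finset.sum_congr rfl fun i _ => by rw [smul_eq_mul, div_eq_inv_mul]
    rw [this]
    linarith

/-- Amplitude amplification of an approximate unitary loses only a constant factor in the error. -/
theorem norm_amplify_sub_le {u p : R} (hu : u ∈ unitary R) {δ : ℝ} (hδ : δ ≤ 1)
    (h : ‖p - u‖ ≤ δ) :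
    ‖(3 / 2 : ℂ) • p - (1 / 2 : ℂ) • (p * star p * p) - u‖ ≤ 5 * δ := by
  have hu1 : ‖u‖ = 1 := CStarRing.norm_of_mem_unitary hu
  have hp : ‖p‖ ≤ 2 := by
    calc ‖p‖ = ‖(p - u) + u‖ := by rw [sub_add_cancel]
      _ ≤ ‖p - u‖ + ‖u‖ := norm_add_le _ _
      _ ≤ 2 := by linarith
  have hδ0 : 0 ≤ δ := (norm_nonneg _).trans h
  have hs : ‖star p - star u‖ ≤ δ := by rwa [← star_sub, norm_star]
  have e : (3 / 2 : ℂ) • p - (1 / 2 : ℂ) • (p * star p * p) - u =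
      (3 / 2 : ℂ) • (p - u) - (1 / 2 : ℂ) • ((p - u) * star p * p + u * (star p - star u) * p +
        u * star u * (p - u)) := by
    have e1 : (p - u) * star p * p + u * (star p - star u) * p + u * star u * (p - u) =
        p * star p * p - u := by
      rw [mul_sub (u * star u), mul_assoc u (star u) u, Unitary.star_mul_self_of_mem hu]
      noncomm_ring
    rw [e1]
    module
  have b1 : ‖(p - u) * star p * p‖ ≤ δ * 2 * 2 := by
    refine (norm_mul_le _ _).trans (mul_le_mul ((norm_mul_le _ _).trans ?_) hp (norm_nonneg _)
      (by positivity))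
    rw [norm_star]
    exact mul_le_mul h hp (norm_nonneg _) hδ0
  have b2 : ‖u * (star p - star u) * p‖ ≤ 1 * δ * 2 := by
    refine (norm_mul_le _ _).trans (mul_le_mul ((norm_mul_le _ _).trans ?_) hp (norm_nonneg _)
      (by positivity))
    exact mul_le_mul hu1.le hs (norm_nonneg _) zero_le_one
  have b3 : ‖u * star u * (p - u)‖ ≤ δ := by
    rw [Unitary.mul_star_self_of_mem hu, one_mul]
    exact h
  rw [e]
  refine (norm_sub_le _ _).trans ?_
  rw [norm_smul, norm_smul]
  have n1 : ‖(3 / 2 : ℂ)‖ = 3 / 2 := by norm_num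
  have n2 : ‖(1 / 2 : ℂ)‖ = 1 / 2 := by norm_num
  rw [n1, n2]
  have := (norm_add_le ((p - u) * star p * p + u * (star p - star u) * p)
    (u * star u * (p - u))).trans (add_le_add_left (norm_add_le _ _) _)
  linarith

theorem norm_pow_sub_pow_le_mul {x y : R} (hx : ‖x‖ ≤ 1) (hy : ‖y‖ ≤ 1) (r : ℕ) :
    ‖x ^ r - y ^ r‖ ≤ r * ‖x - y‖ := by
  induction r with
  | zero => simp
  | succ r ih =>
    have hyr : ‖y ^ r‖ ≤ 1 := (norm_pow_le y r).trans (pow_le_one₀ (norm_nonneg _) hy)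
    have e : x ^ (r + 1) - y ^ (r + 1) = (x ^ r - y ^ r) * x + y ^ r * (x - y) := by
      rw [pow_succ, pow_succ]
      noncomm_ring
    calc ‖x ^ (r + 1) - y ^ (r + 1)‖
        ≤ ‖x ^ r - y ^ r‖ * ‖x‖ + ‖y ^ r‖ * ‖x - y‖ := by
          rw [e]
          exact (norm_add_le _ _).trans (add_le_add (norm_mul_le _ _) (norm_mul_le _ _))
      _ ≤ r * ‖x - y‖ * 1 + 1 * ‖x - y‖ := by gcongr
      _ = ((r + 1 : ℕ) : ℝ) * ‖x - y‖ := by push_cast; ring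

theorem exp_neg_I_smul_mem_unitary {h : R} (hh : IsSelfAdjoint h) (τ : ℝ) :
    NormedSpace.exp ((-(Complex.I * (τ : ℂ))) • h) ∈ unitary R := by
  let : NormedAlgebra ℚ R := NormedAlgebra.restrictScalars ℚ ℂ R
  apply NormedSpace.exp_mem_unitary_of_mem_skewAdjoint
  rw [skewAdjoint.mem_iff, star_smul, hh.star_eq, ← neg_smul]
  congr 1
  simp

/-- Simulation for a short time: half of the Taylor polynomial of the exponential is a linear combination
of powers of `h` with coefficients of total modulus at most `1`, and amplification doubles it. -/
theorem Encodes.exists_approx_exp_of_le_half (hG : IsGateSet G) {m : ℕ} {h : R}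
    (hB : Encodes G m h) (hh : IsSelfAdjoint h) {τ : ℝ} (hτ0 : 0 ≤ τ) (hτ : τ ≤ 1 / 2) {K : ℕ}
    (hK : 0 < K) :
    ∃ B, Encodes G (3 * (K * m)) B ∧
      ‖B - NormedSpace.exp ((-(Complex.I * (τ : ℂ))) • h)‖ ≤ 10 * (1 / 2) ^ K / K.factorial := by
  set z : ℂ := -(Complex.I * (τ : ℂ)) with hz
  have hznorm : ‖z‖ = τ := by simp [hz, abs_of_nonneg hτ0]
  set p : R := ∑ j ∈ Finset.range K, ((j.factorial : ℂ)⁻¹) • (z • h) ^ j with hp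
  have hzh : ‖z • h‖ ≤ τ := by
    rw [norm_smul, hznorm]
    exact mul_le_of_le_one_right hτ0 (hB.norm_le_one hG)
  have hK1 : (1 : ℝ) ≤ K := by exact_mod_cast hK
  have hfact : (1 : ℝ) ≤ K.factorial := by exact_mod_cast Nat.factorial_pos K
  have herr : ‖p - NormedSpace.exp (z • h)‖ ≤ 2 * (1 / 2) ^ K / K.factorial := by
    rw [norm_sub_rev]
    refine (norm_exp_sub_sum_range_le _ (by linarith) hK).trans ?_
    have : ‖z • h‖ ^ K ≤ (1 / 2) ^ K := pow_le_pow_left₀ (norm_nonneg _) (hzh.trans hτ) K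
    rw [div_le_div_iff₀ (by positivity) (by positivity)]
    calc ‖z • h‖ ^ K * (K + 1) * K.factorial ≤ (1 / 2) ^ K * (2 * K) * K.factorial := by
          gcongr
          linarith
      _ = 2 * (1 / 2) ^ K * (K.factorial * K) := by ring
  have henc : Encodes G (K * m) ((1 / 2 : ℂ) • p) := by
    have e : (1 / 2 : ℂ) • p =
        ∑ j : Fin K, ((1 / 2 : ℂ) * (((j : ℕ).factorial : ℂ)⁻¹ * z ^ (j : ℕ))) • h ^ (j : ℕ) := by
      rw [hp, Finset.smul_sum, Finset.sum_range]
      refine Finset.sum_congr rfl fun j _ => ?_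
      rw [smul_pow, smul_smul, smul_smul, mul_assoc]
    rw [e]
    refine Encodes.sum (J := Fin K) hG (fun j => (hB.pow j).mono hG (Nat.mul_le_mul_right m j.2.le)) ?_
    have e2 : ∑ j : Fin K, ‖(1 / 2 : ℂ) * (((j : ℕ).factorial : ℂ)⁻¹ * z ^ (j : ℕ))‖ =
        1 / 2 * ∑ j ∈ Finset.range K, τ ^ j / j.factorial := by
      rw [Finset.mul_sum, Finset.sum_range]
      refine Finset.sum_congr rfl fun j _ => ?_
      rw [norm_mul, norm_mul, norm_inv, norm_pow, hznorm, Complex.norm_natCast]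
      norm_num
      rw [div_eq_inv_mul]
    rw [e2]
    -- The coefficients have total modulus at most `exp (1 / 2) / 2 ≤ 1`.
    have h1 := Real.sum_le_exp_of_nonneg hτ0 K
    have h2 : Real.exp τ ≤ Real.exp (1 / 2) := Real.exp_le_exp.2 hτ
    have h3 : Real.exp (1 / 2) ^ 2 = Real.exp 1 := by
      rw [← Real.exp_nat_mul]
      norm_num
    have h4 := Real.exp_one_lt_d9
    have h5 : Real.exp (1 / 2) ≤ 2 := by nlinarith [Real.exp_pos (1 / 2 : ℝ)]
    linarith
  refine ⟨_, henc.amplify hG, ?_⟩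
  have e : (3 : ℂ) • ((1 / 2 : ℂ) • p) -
      (4 : ℂ) • ((1 / 2 : ℂ) • p * star ((1 / 2 : ℂ) • p) * (1 / 2 : ℂ) • p) =
      (3 / 2 : ℂ) • p - (1 / 2 : ℂ) • (p * star p * p) := by
    have hs : star (1 / 2 : ℂ) = 1 / 2 := by simp
    rw [star_smul, hs]
    simp only [smul_mul_assoc, mul_smul_comm, smul_smul]
    norm_num
  rw [e]
  have hδ : 2 * (1 / 2 : ℝ) ^ K / K.factorial ≤ 1 := by
    rw [div_le_one (by positivity)]
    have : (1 / 2 : ℝ) ^ K ≤ (1 / 2) ^ 1 := pow_le_pow_of_le_one (by norm_num) (by norm_num) hK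
    linarith
  refine (norm_amplify_sub_le (exp_neg_I_smul_mem_unitary hh τ) hδ herr).trans (le_of_eq ?_)
  ring

/-- Simulation for the time `T` in `r` segments. -/
theorem Encodes.exists_approx_exp (hG : IsGateSet G) {m : ℕ} {h : R} (hB : Encodes G m h)
    (hh : IsSelfAdjoint h) {T : ℝ} (hT : 0 ≤ T) {r : ℕ} (hr : 0 < r) (hTr : 2 * T ≤ r) {K : ℕ}
    (hK : 0 < K) :
    ∃ B, Encodes G (r * (3 * (K * m))) B ∧
      ‖B - NormedSpace.exp ((-(Complex.I * (T : ℂ))) • h)‖ ≤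
        r * (10 * (1 / 2) ^ K / K.factorial) := by
  let : NormedAlgebra ℚ R := NormedAlgebra.restrictScalars ℚ ℂ R
  have hr0 : (0 : ℝ) < r := by exact_mod_cast hr
  obtain ⟨B, hBenc, hBerr⟩ := hB.exists_approx_exp_of_le_half hG hh (τ := T / r)
    (by positivity) (by rw [div_le_iff₀ hr0]; linarith) hK
  refine ⟨B ^ r, hBenc.pow r, ?_⟩
  have e : (-(Complex.I * (T : ℂ))) • h = r • ((-(Complex.I * ((T / r : ℝ) : ℂ))) • h) := by
    rw [← Nat.cast_smul_eq_nsmul ℂ, smul_smul]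
    congr 1
    have : (r : ℂ) ≠ 0 := by exact_mod_cast hr.ne'
    push_cast
    field_simp
  rw [e, NormedSpace.exp_nsmul]
  refine (norm_pow_sub_pow_le_mul (hBenc.norm_le_one hG)
    (CStarRing.norm_of_mem_unitary (exp_neg_I_smul_mem_unitary hh _)).le r).trans ?_
  gcongr

end Exponential

/-! ### Local permutations and SWAP gates -/

section Permutations

variable {d n : ℕ}

theorem permOp_one : permOp d (1 : Equiv.Perm (Fin n)) = 1 := by
  ext x y
  simp [permOp, Matrix.one_apply]

theorem permOp_mul (σ τ : Equiv.Perm (Fin n)) : permOp d (σ * τ) = permOp d σ * permOp d τ := by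
  ext x y
  rw [Matrix.mul_apply, Finset.sum_eq_single (y ∘ ⇑τ⁻¹)]
  · simp [permOp, _root_.mul_inv_rev, Function.comp_assoc]
  · intro z _ hz
    simp only [permOp, of_apply, if_neg hz, mul_zero]
  · simp

theorem conjTranspose_permOp (σ : Equiv.Perm (Fin n)) : (permOp d σ)ᴴ = permOp d σ⁻¹ := by
  ext x y
  have : y = x ∘ ⇑σ⁻¹ ↔ x = y ∘ ⇑σ := by
    constructor
    · rintro rfl
      ext i
      simp
    · rintro rfl
      ext i
      simp
  simp only [conjTranspose_apply, permOp, of_apply, this, inv_inv]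
  split_ifs <;> simp

/-- The values that the system part of a controlled SWAP gate may take. -/
def swapOps (d n : ℕ) : Set (Matrix (Config d n) (Config d n) ℂ) :=
  {g | ∃ i j : Fin n, g = permOp d (Equiv.swap i j)}

theorem isGateSet_swapOps [NeZero n] : IsGateSet (swapOps d n) where
  one_mem := ⟨0, 0, by rw [Equiv.swap_self]; exact permOp_one.symm⟩
  star_mem := by
    rintro _ ⟨i, j, rfl⟩
    exact ⟨i, j, by rw [star_eq_conjTranspose, conjTranspose_permOp, Equiv.swap_inv]⟩
  mem_unitary := by
    rintro _ ⟨i, j, rfl⟩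
    rw [Unitary.mem_iff, star_eq_conjTranspose, conjTranspose_permOp, ← permOp_mul, ← permOp_mul,
      inv_mul_cancel, mul_inv_cancel, permOp_one]
    exact ⟨rfl, rfl⟩

/-- A permutation that moves at most `k` points is a product of at most `k` transpositions. -/
theorem encodes_permOp [NeZero n] (k : ℕ) (σ : Equiv.Perm (Fin n)) (hσ : σ.support.card ≤ k) :
    Encodes (swapOps d n) k (permOp d σ) := by
  induction k generalizing σ with
  | zero =>
    rw [Nat.le_zero, Equiv.Perm.card_support_eq_zero] at hσ
    rw [hσ, permOp_one]
    exact encodes_one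
  | succ k ih =>
    by_cases h1 : σ = 1
    · rw [h1, permOp_one]
      exact encodes_one.mono isGateSet_swapOps (Nat.zero_le _)
    · obtain ⟨x, hx⟩ : ∃ x, σ x ≠ x := by
        by_contra! h
        exact h1 (Equiv.ext h)
      have hcard := Equiv.Perm.card_support_swap_mul hx
      have h := ih (Equiv.swap x (σ x) * σ) (by omega)
      have e : permOp d σ = permOp d (Equiv.swap x (σ x)) * permOp d (Equiv.swap x (σ x) * σ) := by
        rw [← permOp_mul, ← mul_assoc, Equiv.swap_mul_self, one_mul]
      rw [e, Nat.add_comm]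
      exact (encodes_of_mem (G := swapOps d n) ⟨x, σ x, rfl⟩).mul h

theorem card_perm_support_subset (S : Finset (Fin n)) :
    (Finset.univ.filter fun σ : Equiv.Perm (Fin n) => σ.support ⊆ S).card = S.card.factorial := by
  rw [← Fintype.card_subtype]
  have e : {σ : Equiv.Perm (Fin n) // σ.support ⊆ S} ≃
      {σ : Equiv.Perm (Fin n) // ∀ a, ¬ a ∈ S → σ a = a} := by
    refine Equiv.subtypeEquivRight fun σ => ?_
    constructor
    · intro h a ha
      by_contra hne
      exact ha (h (Equiv.Perm.mem_support.2 hne))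
    · intro h a ha
      by_contra hne
      exact Equiv.Perm.mem_support.1 ha (h a hne)
  rw [Fintype.card_congr (e.trans (Equiv.Perm.subtypeEquivSubtypePerm (· ∈ S)).symm),
    Fintype.card_perm, Fintype.card_coe]

theorem card_perm_card_support_le (hn : 0 < n) (k : ℕ) :
    (Finset.univ.filter fun σ : Equiv.Perm (Fin n) => σ.support.card ≤ k).card ≤ n ^ k := by
  rcases le_total k n with hk | hk
  · calc (Finset.univ.filter fun σ : Equiv.Perm (Fin n) => σ.support.card ≤ k).card
        ≤ ((Finset.powersetCard k (Finset.univ : Finset (Fin n))).biUnion fun S =>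
            Finset.univ.filter fun σ : Equiv.Perm (Fin n) => σ.support ⊆ S).card := by
          refine Finset.card_le_card fun σ hσ => ?_
          rw [Finset.mem_filter] at hσ
          obtain ⟨S, hS, -, hSc⟩ := Finset.exists_subsuperset_card_eq
            (Finset.subset_univ σ.support) hσ.2 (by simpa using hk)
          simp only [Finset.mem_biUnion, Finset.mem_powersetCard, Finset.mem_filter]
          exact ⟨S, ⟨Finset.subset_univ S, hSc⟩, Finset.mem_univ σ, hS⟩
      _ ≤ (Finset.powersetCard k (Finset.univ : Finset (Fin n))).card * k.factorial := by
          refine Finset.card_biUnion_le_card_mul _ _ _ fun S hS => ?_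
          rw [card_perm_support_subset, (Finset.mem_powersetCard.1 hS).2]
      _ = n.descFactorial k := by
          rw [Finset.card_powersetCard, Finset.card_univ, Fintype.card_fin,
            Nat.descFactorial_eq_factorial_mul_choose, Nat.mul_comm]
      _ ≤ n ^ k := Nat.descFactorial_le_pow n k
  · calc _ ≤ (Finset.univ : Finset (Equiv.Perm (Fin n))).card :=
          Finset.card_le_card (Finset.filter_subset _ _)
      _ = n.factorial := by rw [Finset.card_univ, Fintype.card_perm, Fintype.card_fin]
      _ ≤ n ^ n := Nat.factorial_le_pow n
      _ ≤ n ^ k := Nat.pow_le_pow_right hn hk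

theorem norm_coeff_le_maxCoeff (f : MonoidAlgebra ℂ (Equiv.Perm (Fin n)))
    (σ : Equiv.Perm (Fin n)) : ‖f.coeff σ‖ ≤ maxCoeff f :=
  le_ciSup (f := fun σ => ‖f.coeff σ‖) (Set.finite_range _).bddAbove σ

theorem sum_norm_coeff_le (hn : 0 < n) {k : ℕ} {f : MonoidAlgebra ℂ (Equiv.Perm (Fin n))}
    (hf : IsLocal k f) : ∑ σ, ‖f.coeff σ‖ ≤ maxCoeff f * (n : ℝ) ^ k := by
  have hC : 0 ≤ maxCoeff f := (norm_nonneg _).trans (norm_coeff_le_maxCoeff f 1)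
  calc ∑ σ, ‖f.coeff σ‖
      = ∑ σ ∈ Finset.univ.filter fun σ : Equiv.Perm (Fin n) => σ.support.card ≤ k,
          ‖f.coeff σ‖ := by
        symm
        refine Finset.sum_subset (Finset.filter_subset _ _) fun σ _ hσ => ?_
        rw [norm_eq_zero]
        by_contra h
        exact hσ (Finset.mem_filter.2 ⟨Finset.mem_univ σ, hf σ h⟩)
    _ ≤ (Finset.univ.filter fun σ : Equiv.Perm (Fin n) => σ.support.card ≤ k).card •
          maxCoeff f := Finset.sum_le_card_nsmul _ _ _ fun σ _ => norm_coeff_le_maxCoeff f σ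
    _ ≤ maxCoeff f * (n : ℝ) ^ k := by
        rw [nsmul_eq_mul, mul_comm]
        gcongr
        exact_mod_cast card_perm_card_support_le hn k

/-- The normalized Hamiltonian is block-encoded with `k` gates: all its terms run side by side. -/
theorem encodes_groupAlgOp [NeZero n] {k : ℕ} {f : MonoidAlgebra ℂ (Equiv.Perm (Fin n))}
    (hf : IsLocal k f) {Λ : ℝ} (hΛ : 0 < Λ) (hfΛ : ∑ σ, ‖f.coeff σ‖ ≤ Λ) :
    Encodes (swapOps d n) k (((Λ⁻¹ : ℝ) : ℂ) • groupAlgOp d f) := by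
  -- Terms with coefficient `0` need not be local, so the operators there are replaced by `0`.
  have h := Encodes.sum (G := swapOps d n) isGateSet_swapOps (m := k)
    (B := fun σ : Equiv.Perm (Fin n) => if f.coeff σ = 0 then 0 else permOp d σ)
    (c := fun σ => ((Λ⁻¹ : ℝ) : ℂ) * f.coeff σ)
    (fun σ => by
      by_cases h0 : f.coeff σ = 0
      · simpa [h0] using encodes_zero isGateSet_swapOps k
      · simpa [h0] using encodes_permOp k σ (hf σ h0))
    (by
      simp only [norm_mul, Complex.norm_real, Real.norm_of_nonneg (inv_nonneg.2 hΛ.le)]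
      rw [← Finset.mul_sum, inv_mul_le_one₀ hΛ]
      exact hfΛ)
  convert h using 1
  rw [groupAlgOp, Finset.smul_sum]
  refine Finset.sum_congr rfl fun σ _ => ?_
  by_cases h0 : f.coeff σ = 0 <;> simp [h0, smul_smul]

end Permutations

/-! ### From circuit operators to circuits -/

section Circuits

variable {d a n : ℕ}

theorem Circuit.toMatrix_append (c c' : Circuit d a n) :
    Circuit.toMatrix (c ++ c') = Circuit.toMatrix c' * Circuit.toMatrix c := by
  induction c with
  | nil => simp [Circuit.toMatrix]
  | cons g c ih => simp [Circuit.toMatrix, ih, Matrix.mul_assoc]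

theorem Circuit.swapCount_append (c c' : Circuit d a n) :
    Circuit.swapCount (c ++ c') = Circuit.swapCount c + Circuit.swapCount c' := by
  induction c with
  | nil => simp [Circuit.swapCount]
  | cons g c ih => cases g <;> simp [Circuit.swapCount, ih, Nat.add_right_comm]

theorem toMatrix_ancilla (V : Matrix.unitaryGroup (Config d a) ℂ) :
    (Gate.ancilla V : Gate d a n).toMatrix = compRingEquiv (Config d a) (Config d n) ℂ
      (V.1.map (algebraMap ℂ (Matrix (Config d n) (Config d n) ℂ))) := by
  ext ⟨b, x⟩ ⟨b', x'⟩
  simp [Gate.toMatrix, kroneckerMap_apply, Matrix.algebraMap_matrix_apply, Matrix.one_apply]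

theorem toMatrix_swap (p q : Config d a → Fin n) :
    (Gate.swap p q : Gate d a n).toMatrix = compRingEquiv (Config d a) (Config d n) ℂ
      (diagonal fun b => permOp d (Equiv.swap (p b) (q b))) := by
  ext ⟨b, x⟩ ⟨b', x'⟩
  by_cases h : b = b'
  · subst h
    simp [Gate.toMatrix]
  · simp [Gate.toMatrix, h]

/-- A circuit operator on `a` ancilla qudits is the operator of a circuit with as many SWAP gates. -/
theorem IsCircuitOp.exists_circuit {m : ℕ}
    {M : Matrix (Config d a) (Config d a) (Matrix (Config d n) (Config d n) ℂ)}
    (hM : IsCircuitOp (swapOps d n) m M) :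
    ∃ W : Circuit d a n, W.swapCount = m ∧
      W.toMatrix = compRingEquiv (Config d a) (Config d n) ℂ M := by
  induction m generalizing M with
  | zero =>
    obtain ⟨V, hV, rfl⟩ := hM
    refine ⟨[.ancilla ⟨V, hV⟩], rfl, ?_⟩
    rw [Circuit.toMatrix, Circuit.toMatrix, Matrix.one_mul, toMatrix_ancilla]
  | succ m ih =>
    obtain ⟨V, hV, g, hg, M', hM', rfl⟩ := hM
    obtain ⟨W, hWc, hW⟩ := ih hM'
    choose p q hpq using hg
    refine ⟨W ++ [.swap p q, .ancilla ⟨V, hV⟩], ?_, ?_⟩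
    · rw [Circuit.swapCount_append, hWc]
      rfl
    · rw [Circuit.toMatrix_append, hW, map_mul, map_mul, funext hpq, ← toMatrix_swap]
      simp only [Circuit.toMatrix, Matrix.one_mul, toMatrix_ancilla]

theorem matrixElement_withAncilla [NeZero d]
    (M : Matrix (Config d a) (Config d a) (Matrix (Config d n) (Config d n) ℂ))
    (u v : Config d n → ℂ) :
    matrixElement (withAncilla a u) (compRingEquiv (Config d a) (Config d n) ℂ M)
      (withAncilla a v) = matrixElement u (M 0 0) v := by
  have h : ∀ x, (compRingEquiv (Config d a) (Config d n) ℂ M *ᵥ withAncilla a v) (0, x) =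
      (M 0 0 *ᵥ v) x := by
    intro x
    simp only [mulVec, dotProduct, Fintype.sum_prod_type]
    rw [Finset.sum_eq_single 0]
    · simp [withAncilla]
    · intro b _ hb
      simp [withAncilla, hb]
    · simp
  simp only [matrixElement, dotProduct, Fintype.sum_prod_type]
  rw [Finset.sum_eq_single 0]
  · simp only [h]
    simp [withAncilla]
  · intro b _ hb
    simp [withAncilla, hb]
  · simp

/-- A block encoding over any finite register is realized by a circuit on sufficiently many ancilla
qudits whose register starts in `|0 ⋯ 0⟩`. -/
theorem Encodes.exists_circuit [NeZero n] [NeZero d] (hd : 2 ≤ d) {m : ℕ}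
    {B : Matrix (Config d n) (Config d n) ℂ} (hB : Encodes (swapOps d n) m B) :
    ∃ (a : ℕ) (W : Circuit d a n), W.swapCount = m ∧ ∀ u v : Config d n → ℂ,
      matrixElement (withAncilla a u) W.toMatrix (withAncilla a v) = matrixElement u B v := by
  obtain ⟨ι, _, _, i₀, M, hM, rfl⟩ := hB
  set a := Fintype.card ι with ha
  have hcard : a ≤ d ^ a := (Nat.lt_pow_self hd).le
  have e₀ : Config d a ≃ ι ⊕ Fin (d ^ a - a) := by
    apply Fintype.equivOfCardEq
    simp only [Fintype.card_pi, Fintype.card_fin, Finset.prod_const, Finset.card_univ,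
      Fintype.card_sum]
    omega
  let e : Config d a ≃ ι ⊕ Fin (d ^ a - a) := e₀.trans (Equiv.swap (e₀ 0) (Sum.inl i₀))
  have he : e 0 = Sum.inl i₀ := by simp [e]
  obtain ⟨W, hWc, hW⟩ :=
    ((hM.fromBlocks_one (κ := Fin (d ^ a - a)) isGateSet_swapOps).submatrix e).exists_circuit
  refine ⟨a, W, hWc, fun u v => ?_⟩
  rw [hW, matrixElement_withAncilla, Matrix.submatrix_apply, he, Matrix.fromBlocks_apply₁₁]

end Circuits

/-! ### Matrix elements and the parameters of the simulation -/

section MatrixElements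

open scoped Matrix.Norms.L2Operator

theorem norm_toLp_column {d n : ℕ} (U : Matrix.unitaryGroup (Config d n) ℂ) (x : Config d n) :
    ‖WithLp.toLp 2 (column U x)‖ = 1 := by
  have h := congr_fun₂ (mem_unitaryGroup_iff'.1 U.2) x x
  rw [star_eq_conjTranspose, Matrix.mul_apply, one_apply_eq] at h
  have h2 : ∑ z, ‖U.1 z x‖ ^ 2 = 1 := by
    have : ((∑ z, ‖U.1 z x‖ ^ 2 : ℝ) : ℂ) = 1 := by
      rw [← h]
      push_cast
      refine Finset.sum_congr rfl fun z _ => ?_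
      rw [conjTranspose_apply, ← Complex.conj_mul']
      rfl
    exact_mod_cast this
  rw [EuclideanSpace.norm_eq]
  simp [column, h2]

theorem norm_matrixElement_column_le {d n : ℕ} (U : Matrix.unitaryGroup (Config d n) ℂ)
    (x y : Config d n) (M : Matrix (Config d n) (Config d n) ℂ) :
    ‖matrixElement (column U x) M (column U y)‖ ≤ ‖M‖ := by
  have e : matrixElement (column U x) M (column U y) =
      inner ℂ (WithLp.toLp 2 (column U x)) (WithLp.toLp 2 (M *ᵥ column U y)) := by
    rw [EuclideanSpace.inner_eq_star_dotProduct, matrixElement, dotProduct_comm]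
  have h := l2_opNorm_mulVec M (WithLp.toLp 2 (column U y))
  rw [norm_toLp_column, mul_one] at h
  rw [e]
  refine (norm_inner_le_norm _ _).trans ?_
  rw [norm_toLp_column, one_mul]
  exact h

theorem matrixElement_sub {ι : Type} [Fintype ι] (u v : ι → ℂ) (M N : Matrix ι ι ℂ) :
    matrixElement u M v - matrixElement u N v = matrixElement u (M - N) v := by
  rw [matrixElement, matrixElement, matrixElement, sub_mulVec, dotProduct_sub]

end MatrixElements

section Parameters

theorem one_le_div_log {y : ℝ} (hy : 1 < y) : 1 ≤ y / Real.log y := by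
  rw [one_le_div (Real.log_pos hy)]
  have := Real.log_le_sub_one_of_pos (zero_lt_one.trans hy)
  linarith

/-- The factorial of `K` reaches `exp y` at `K` of order `y / log y`, the inverse of Stirling's
formula. -/
theorem exp_le_factorial {y : ℝ} (hy : 1 < y) {K : ℕ} (hK : 6 * (y / Real.log y) ≤ K) :
    Real.exp y ≤ K.factorial := by
  have hy0 : 0 < y := zero_lt_one.trans hy
  have hlog := Real.log_pos hy
  have hKy : 6 * y ≤ K * Real.log y := by
    rw [← mul_div_assoc, div_le_iff₀ hlog] at hK
    exact hK
  -- The term `x ^ K / K!` of the exponential series is used at `x = √y`.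
  have h := Real.pow_div_factorial_le_exp (Real.sqrt y) (Real.sqrt_nonneg y) K
  rw [div_le_iff₀ (by positivity)] at h
  have hpow : Real.sqrt y ^ K = Real.exp (K * Real.log y / 2) := by
    rw [← Real.exp_log (Real.sqrt_pos.2 hy0), Real.log_sqrt hy0.le, ← Real.exp_nat_mul]
    congr 1
    ring
  have hsqrt : Real.sqrt y ≤ y := by
    rw [Real.sqrt_le_left hy0.le]
    nlinarith
  rw [hpow] at h
  have h2 : Real.exp (y + Real.sqrt y) ≤ Real.exp (K * Real.log y / 2) :=
    Real.exp_le_exp.2 (by linarith)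
  rw [Real.exp_add, mul_comm] at h2
  exact le_of_mul_le_mul_left (h2.trans h) (Real.exp_pos _)

end Parameters

/-! ### Simulation of a local Hamiltonian -/

open scoped Matrix.Norms.L2Operator in
/-- The simulation in operator norm. With `T = t C nᵏ` and `y = log (k T / ε)`, the evolution is cut into
`r = ⌈2 k T⌉` segments, the assumption `k T ≥ 1` keeping `r` of order `k T`, and the exponential is
truncated at order `K = ⌈6 y / log y⌉`, where `K!` exceeds `k T / ε`. -/
theorem exists_circuit_approx_exp {d n k : ℕ} [NeZero d] (hd : 2 ≤ d)
    {f : MonoidAlgebra ℂ (Equiv.Perm (Fin n))} (hf : IsLocal k f)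
    (hH : (groupAlgOp d f).IsHermitian) {t ε : ℝ} (ht : 0 < t) (hε : 0 < ε)
    (h1 : 1 ≤ t * maxCoeff f * k * (n : ℝ) ^ k)
    (hX : Real.exp 1 < t * maxCoeff f * k * (n : ℝ) ^ k / ε) :
    ∃ (a : ℕ) (W : Circuit d a n),
      (W.swapCount : ℝ) ≤ 63 * (t * maxCoeff f * (k : ℝ) ^ 3 * (n : ℝ) ^ k *
        (Real.log (t * maxCoeff f * k * (n : ℝ) ^ k / ε) /
          Real.log (Real.log (t * maxCoeff f * k * (n : ℝ) ^ k / ε)))) ∧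
      ∃ B : Matrix (Config d n) (Config d n) ℂ,
        (∀ u v, matrixElement (withAncilla a u) W.toMatrix (withAncilla a v) =
          matrixElement u B v) ∧
        ‖B - NormedSpace.exp ((-(Complex.I * (t : ℂ))) • groupAlgOp d f)‖ ≤ ε := by
  have hk : k ≠ 0 := by
    rintro rfl
    norm_num at h1
  have hn : n ≠ 0 := by
    rintro rfl
    norm_num [hk] at h1
  have : NeZero n := ⟨hn⟩
  have hk1 : (1 : ℝ) ≤ k := by exact_mod_cast Nat.one_le_iff_ne_zero.2 hk
  set C := maxCoeff f
  set Λ : ℝ := C * (n : ℝ) ^ k with hΛdef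
  have hΛ : 0 < Λ := by
    by_contra! hneg
    have : t * C * k * (n : ℝ) ^ k = (t * k) * Λ := by rw [hΛdef]; ring
    rw [this] at h1
    nlinarith [mul_nonneg ht.le (zero_le_one.trans hk1)]
  set T : ℝ := t * Λ with hTdef
  have hT : 0 < T := mul_pos ht hΛ
  have eT : t * C * k * (n : ℝ) ^ k = k * T := by rw [hTdef, hΛdef]; ring
  have eT3 : t * C * (k : ℝ) ^ 3 * (n : ℝ) ^ k = k ^ 3 * T := by rw [hTdef, hΛdef]; ring
  rw [eT] at h1 hX ⊢
  rw [eT3]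
  set X : ℝ := k * T / ε with hXdef
  have hX0 : 0 < X := (Real.exp_pos 1).trans hX
  set y : ℝ := Real.log X
  have hy : 1 < y := (Real.lt_log_iff_exp_lt hX0).2 hX
  have hyX : Real.exp y = X := Real.exp_log hX0
  set q : ℝ := y / Real.log y
  have hq : 1 ≤ q := one_le_div_log hy
  set K : ℕ := ⌈6 * q⌉₊
  have hK6 : 6 * q ≤ K := Nat.le_ceil _
  have hK7 : (K : ℝ) ≤ 7 * q := by
    have := (Nat.ceil_lt_add_one (by positivity : 0 ≤ 6 * q)).le
    linarith
  have hK : 6 ≤ K := by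
    have : (6 : ℝ) ≤ K := by linarith
    exact_mod_cast this
  have hfact : X ≤ K.factorial := hyX ▸ exp_le_factorial hy hK6
  set r : ℕ := ⌈2 * (k * T)⌉₊
  have hr2 : 2 * (k * T) ≤ r := Nat.le_ceil _
  have hr3 : (r : ℝ) ≤ 3 * (k * T) := by
    have := (Nat.ceil_lt_add_one (by positivity : 0 ≤ 2 * (k * T))).le
    linarith
  have hr : 0 < r := by
    have : (0 : ℝ) < r := by linarith
    exact_mod_cast this
  have hTr : 2 * T ≤ r := by nlinarith
  have henc := encodes_groupAlgOp (d := d) hf hΛ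
    (sum_norm_coeff_le (Nat.pos_of_ne_zero hn) hf)
  have hsa : IsSelfAdjoint (((Λ⁻¹ : ℝ) : ℂ) • groupAlgOp d f) := by
    refine IsSelfAdjoint.smul ?_ hH
    rw [isSelfAdjoint_iff, Complex.star_def, Complex.conj_ofReal]
  have : Nonempty (Fin d) := ⟨0⟩
  obtain ⟨B, hB, hBerr⟩ := henc.exists_approx_exp isGateSet_swapOps hsa hT.le hr hTr
    (by omega : 0 < K)
  obtain ⟨a, W, hWc, hW⟩ := hB.exists_circuit hd
  refine ⟨a, W, ?_, B, hW, ?_⟩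
  · rw [hWc]
    push_cast
    -- The constant is `63 = 3 * 3 * 7`, from `r ≤ 3 k T`, amplification and `K ≤ 7 q`.
    calc (r : ℝ) * (3 * (K * k)) ≤ 3 * (k * T) * (3 * (7 * q * k)) := by gcongr
      _ = 63 * (k ^ 2 * T * q) := by ring
      _ ≤ 63 * (k ^ 3 * T * q) := by
        gcongr
        norm_num
  · have e : (-(Complex.I * (T : ℂ))) • (((Λ⁻¹ : ℝ) : ℂ) • groupAlgOp d f) =
        (-(Complex.I * (t : ℂ))) • groupAlgOp d f := by
      rw [smul_smul]
      congr 1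
      have : (Λ : ℂ) ≠ 0 := by exact_mod_cast hΛ.ne'
      rw [hTdef]
      push_cast
      field_simp
    rw [e] at hBerr
    refine hBerr.trans ?_
    have hpow : (1 / 2 : ℝ) ^ K ≤ 1 / 30 :=
      (pow_le_pow_of_le_one (by norm_num) (by norm_num) hK).trans (by norm_num)
    rw [← mul_div_assoc, div_le_iff₀ (by positivity)]
    calc (r : ℝ) * (10 * (1 / 2) ^ K) ≤ 3 * (k * T) * (10 * (1 / 30)) := by gcongr
      _ = ε * X := by
        rw [hXdef]
        field_simp
        norm_num
      _ ≤ ε * K.factorial := by gcongr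

end QuditSim

theorem theorem1 :
    ∃ A : ℝ, 0 < A ∧
      ∀ (d n k : ℕ) [NeZero d], 2 ≤ d →
      ∀ f : MonoidAlgebra ℂ (Equiv.Perm (Fin n)),
        QuditSim.IsLocal k f → (QuditSim.groupAlgOp d f).IsHermitian →
      ∀ t ε : ℝ, 0 < t → 0 < ε →
        1 ≤ t * QuditSim.maxCoeff f * k * (n : ℝ) ^ k →
        Real.exp 1 < t * QuditSim.maxCoeff f * k * (n : ℝ) ^ k / ε →
      ∃ (a : ℕ) (W : QuditSim.Circuit d a n),
        (W.swapCount : ℝ) ≤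
          A * (t * QuditSim.maxCoeff f * (k : ℝ) ^ 3 * (n : ℝ) ^ k *
            (Real.log (t * QuditSim.maxCoeff f * k * (n : ℝ) ^ k / ε) /
              Real.log (Real.log (t * QuditSim.maxCoeff f * k * (n : ℝ) ^ k / ε)))) ∧
        ∀ U : Matrix.unitaryGroup (QuditSim.Config d n) ℂ, QuditSim.IsYoungSchurTransform U →
        ∀ x y : QuditSim.Config d n,
          ‖QuditSim.matrixElement
                (QuditSim.withAncilla a (QuditSim.column U x)) W.toMatrix
                (QuditSim.withAncilla a (QuditSim.column U y)) -
              QuditSim.matrixElement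
                (QuditSim.column U x)
                (NormedSpace.exp ((-(Complex.I * (t : ℂ))) • QuditSim.groupAlgOp d f))
                (QuditSim.column U y)‖ ≤ ε := by
  refine ⟨63, by norm_num, fun d n k _ hd f hf hH t ε ht hε h1 hX => ?_⟩
  obtain ⟨a, W, hWc, B, hB, hBerr⟩ :=
    QuditSim.exists_circuit_approx_exp hd hf hH ht hε h1 hX
  refine ⟨a, W, hWc, fun U _ x y => ?_⟩
  rw [hB, QuditSim.matrixElement_sub]
  exact (QuditSim.norm_matrixElement_column_le U x y _).trans hBerr
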